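/- Soundness of guarded attribute grammars is undecidable, in the following sense. **Grammars.** Fix a finite ranked alphabet and finitely many sorts, each sort $s$ with a number $n$ of inherited and a number $m$ of synthesized attributes. A *form* of sort $s$ is an expression $F=s(t_1,\dots,t_n)\langle u_1,\dots,u_m\rangle$ where the $t_i$, $u_j$ are (finite) terms over the alphabet and variables; it is a *service call* if $u_1,\dots,u_m$ are pairwise distinct variables. A *guarded attribute grammar* is a finite list of productions $P: F_0\leftarrow F_1\cdots F_k$ ($k\ge 0$) of forms such that the synthesized attributes of $F_1,\dots,F_k$ are variables and every variable has at most one input occurrence, i.e. at most one occurrence in the inherited attributes of $F_0$ and the synthesized attributes of $F_1,\dots,F_k$ taken together. It is given with a finite *interface*, i.e. a finite list of service calls called its *services*. **Configurations.** A configuration $\Gamma$ is a set of nodes $X$, each with a defining equation, either $X=P(X_1,\dots,X_k)$ (*closed* node, labelled by a production $P$, with successor nodes $X_i$) or $X=s(d_1,\dots,d_n)\langle y_1,\dots,y_m\rangle$ (*open* node, with a service call). A configuration is *closed* if all its nodes are closed. **Steps.** Let $X=s(d_1,\dots,d_n)\langle y_1,\dots,y_m\rangle$ be an open node of $\Gamma$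 and $P:F_0\leftarrow F_1\cdots F_k$ a production, with its variables injectively renamed so as to be disjoint from those of $\Gamma$, and with $F_0=s(p_1,\dots,p_n)\langle u_1,\dots,u_m\rangle$ of the same sort. Then $P$ is *enabled* at $X$ if (i) the patterns match the data: there is a substitution $\sigma_{\mathrm{in}}$ of the variables of the $p_i$ with $p_i\sigma_{\mathrm{in}}=d_i$ for all $i$; and (ii) the system $\{y_j=u_j\sigma_{\mathrm{in}}\mid 1\le j\le m\}$ is acyclic, i.e. the relation "$y_j$ occurs in $u_i\sigma_{\mathrm{in}}$" on indices $(i,j)$ has no cycle; its solved form, obtained by repeatedly replacing the $y_j$ by their definitions in the right-hand sides, is a substitution $\sigma_{\mathrm{out}}$. Put $\sigma=\sigma_{\mathrm{out}}\cup\sigma_{\mathrm{in}}\sigma_{\mathrm{out}}$. Applying $P$ at $X$ yields $$\Gamma'=\{X=P(X_1,\dots,X_k)\}\cup\{X_i=F_i\sigma\mid 1\le i\le k\}\cup\{X'=F\sigma\mid (X'=F)\in\Gamma,\ X'\ne X\}$$ where $X_1,\dots,X_k$ are distinct new nodes and closed nodes are left unchanged. $\Gamma'$ is *accessible* from $\Gamma$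 if it is obtained by finitely many (possibly zero) such steps. **Soundness.** A *case* is an instance $c=s(t_1\sigma,\dots,t_n\sigma)\langle x_1,\dots,x_m\rangle$ of a service $s(t_1,\dots,t_n)\langle x_1,\dots,x_m\rangle$, where $\sigma$ is a substitution that fixes $x_1,\dots,x_m$ and the variables of the terms $t_i\sigma$ are among $x_1,\dots,x_m$. The grammar with its interface is *sound* if, for every case $c$ and every configuration $\Gamma$ accessible from the initial configuration $\{X_0=c\}$, some closed configuration is accessible from $\Gamma$. **Theorem.** There is no algorithm that decides, given a guarded attribute grammar with its interface, whether it is sound. That is, for the standard numbering of finite presentations, there is no total computable Boolean function whose value on every presentation of a guarded attribute grammar with its interface is true if and only if that grammar is sound. -/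

import Mathlib

namespace GuardedAttributeGrammar

/-! ## Terms over a ranked alphabet -/

/-- Terms: variables and symbols of the alphabet are named by natural numbers. That every symbol is
used with its rank is expressed by `Term.Over`. -/
inductive Term : Type
  | var (x : ℕ) : Term
  | app (c : ℕ) (ts : List Term) : Term

namespace Term

/-- `t.Over ranks`: `t` is a term over the ranked alphabet whose symbols are the `c < ranks.length`,
the symbol `c` having rank `ranks[c]`. -/
inductive Over (ranks : List ℕ) : Term → Prop
  | var (x : ℕ) : Over ranks (Term.var x)
  | app (c : ℕ) (ts : List Term) (hc : ranks[c]? = some ts.length)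
      (hts : ∀ t ∈ ts, Over ranks t) : Over ranks (Term.app c ts)

mutual
/-- The list of the occurrences of variables in a term, from left to right. -/
def occ : Term → List ℕ
  | .var x => [x]
  | .app _ ts => occList ts
/-- The list of the occurrences of variables in a list of terms. -/
def occList : List Term → List ℕ
  | [] => []
  | t :: ts => occ t ++ occList ts
end

mutual
/-- The term `t σ`. -/
def subst (σ : ℕ → Term) : Term → Term
  | .var x => σ x
  | .app c ts => .app c (substList σ ts)
/-- The list of terms `t₁ σ, …, tₙ σ`. -/
def substList (σ : ℕ → Term) : List Term → List Term
  | [] => []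
  | t :: ts => subst σ t :: substList σ ts
end

end Term

/-! ## Systems of equations `x = t` -/

/-- A system of equations `x = t` (with pairwise distinct left-hand sides in all uses). -/
abbrev Equations : Type := List (ℕ × Term)

namespace Equations

/-- The variables that are left-hand sides of equations of the system. -/
def dom (E : Equations) : List ℕ := E.map Prod.fst

/-- The substitution that replaces `x` by `t` for every equation `x = t`, and fixes all other
variables. -/
def toSubst (E : Equations) : ℕ → Term := fun x => (E.lookup x).getD (Term.var x)

/-- Apply a substitution to all the right-hand sides. -/
def substRhs (E : Equations) (σ : ℕ → Term) : Equations := E.map fun e => (e.1, e.2.subst σ)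

/-- `x ≻ y`: the variables `x` and `y` are in the domain and `y` occurs in the definition of `x`. -/
def DependsOn (E : Equations) (x y : ℕ) : Prop := ∃ t, (x, t) ∈ E ∧ y ∈ t.occ ∧ y ∈ E.dom

/-- The dependency relation has no cycle. -/
def Acyclic (E : Equations) : Prop := ∀ x, ¬ Relation.TransGen E.DependsOn x x

/-- `E'` is the solved form of `E`: it is obtained by repeatedly replacing, in the right-hand sides,
the variables of the domain by their definitions in `E`, until none of them is left. -/
def IsSolvedForm (E E' : Equations) : Prop :=
  (∃ n : ℕ, E' = (fun S : Equations => S.substRhs E.toSubst)^[n] E) ∧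
    ∀ e ∈ E', ∀ y ∈ e.2.occ, y ∉ E.dom

end Equations

/-! ## Pattern matching -/

namespace Term

mutual
/-- `match(p, d)`: the system of equations resulting from the matching of the pattern `p` with the
data `d`, and `none` if the matching fails. -/
def matching : Term → Term → Option Equations
  | .var x, d => some [(x, d)]
  | .app c ps, .app c' ds => if c = c' then matchingList ps ds else none
  | .app _ _, .var _ => none
/-- The matching of a list of patterns with a list of data. In all uses, no variable occurs twice in
the patterns, so that the union below is a union of substitutions with disjoint domains. -/
def matchingList : List Term → List Term → Option Equations
  | [], [] => some []
  | p :: ps, d :: ds =>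
    match matching p d, matchingList ps ds with
    | some E, some E' => some (E ++ E')
    | _, _ => none
  | [], _ :: _ => none
  | _ :: _, [] => none
end

end Term

/-! ## Forms, productions, grammars -/

/-- A form `s(t₁, …, tₙ)⟨u₁, …, uₘ⟩`. -/
structure Form : Type where
  /-- the sort `s` -/
  sort : ℕ
  /-- the values `t₁, …, tₙ` of the inherited attributes -/
  inh : List Term
  /-- the values `u₁, …, uₘ` of the synthesized attributes -/
  syn : List Term

namespace Form

/-- The occurrences of variables in a form. -/
def occ (F : Form) : List ℕ := Term.occList F.inh ++ Term.occList F.syn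

/-- The form `F σ`. -/
def subst (F : Form) (σ : ℕ → Term) : Form :=
  ⟨F.sort, Term.substList σ F.inh, Term.substList σ F.syn⟩

/-- `F` is a form over the given ranked alphabet and sorts: `sorts[s] = (n, m)` says that the sort `s`
has `n` inherited and `m` synthesized attributes. -/
def Over (ranks : List ℕ) (sorts : List (ℕ × ℕ)) (F : Form) : Prop :=
  sorts[F.sort]? = some (F.inh.length, F.syn.length) ∧
    (∀ t ∈ F.inh, t.Over ranks) ∧ ∀ u ∈ F.syn, u.Over ranks

/-- `F` is a service call: its synthesized positions are distinct variables. -/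
def IsServiceCall (F : Form) : Prop := ∃ ys : List ℕ, F.syn = ys.map Term.var ∧ ys.Nodup

/-- `F.Matches F' σ`: the form `F = s(p₁, …, pₙ)⟨u₁, …, uₘ⟩` matches with the service call
`F' = s(d₁, …, dₙ)⟨y₁, …, yₘ⟩`, with resulting substitution `σ = σ_out ∪ σ_in σ_out`. -/
def Matches (F F' : Form) (σ : Equations) : Prop :=
  F.sort = F'.sort ∧
  ∃ (ys : List ℕ) (σin σout : Equations),
    F'.syn = ys.map Term.var ∧
    F.syn.length = ys.length ∧
    Term.matchingList F.inh F'.inh = some σin ∧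
    Equations.Acyclic (ys.zip (Term.substList σin.toSubst F.syn)) ∧
    Equations.IsSolvedForm (ys.zip (Term.substList σin.toSubst F.syn)) σout ∧
    σ = σout ++ σin.substRhs σout.toSubst

end Form

/-- A production `F₀ ← F₁ ⋯ Fₖ`. -/
structure Production : Type where
  /-- the left-hand side `F₀` -/
  lhs : Form
  /-- the right-hand side `F₁ ⋯ Fₖ` -/
  rhs : List Form

namespace Production

/-- The occurrences of variables in a production. -/
def occ (P : Production) : List ℕ := P.lhs.occ ++ P.rhs.flatMap Form.occ

/-- The input occurrences of variables: those in the patterns, i.e. the inherited attributes of the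
left-hand side, and those in the synthesized attributes of the right-hand side. -/
def inputOcc (P : Production) : List ℕ :=
  Term.occList P.lhs.inh ++ P.rhs.flatMap fun F => Term.occList F.syn

/-- Rename the variables of a production. -/
def rename (P : Production) (ρ : ℕ → ℕ) : Production :=
  ⟨P.lhs.subst fun x => Term.var (ρ x), P.rhs.map fun F => F.subst fun x => Term.var (ρ x)⟩

/-- The conditions on the productions of a guarded attribute grammar: the synthesized attributes in
the right-hand side are variables and every variable has at most one input occurrence. -/
def WellFormed (ranks : List ℕ) (sorts : List (ℕ × ℕ)) (P : Production) : Prop :=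
  P.lhs.Over ranks sorts ∧
  (∀ F ∈ P.rhs, F.Over ranks sorts ∧ ∃ ys : List ℕ, F.syn = ys.map Term.var) ∧
  P.inputOcc.Nodup

end Production

/-- A finite presentation of a guarded attribute grammar with its interface. -/
structure Grammar : Type where
  /-- the ranks of the symbols of the alphabet of attribute values -/
  ranks : List ℕ
  /-- the numbers of inherited and of synthesized attributes of the sorts -/
  sorts : List (ℕ × ℕ)
  /-- the productions -/
  prods : List Production
  /-- the services, which form the interface -/
  services : List Form

/-- The presentation does describe a guarded attribute grammar with an interface. -/
def Grammar.WellFormed (G : Grammar) : Prop :=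
  (∀ P ∈ G.prods, P.WellFormed G.ranks G.sorts) ∧
    ∀ F ∈ G.services, F.Over G.ranks G.sorts ∧ F.IsServiceCall

/-! ## Configurations and their evolution -/

/-- The right-hand sides of the defining equations of nodes. -/
inductive NodeDef : Type
  /-- `X = P(X₁, …, Xₖ)`, where `P` is the production with number `p` -/
  | closed (p : ℕ) (succs : List ℕ) : NodeDef
  /-- `X = s(t₁, …, tₙ)⟨x₁, …, xₘ⟩` -/
  | opened (F : Form) : NodeDef

/-- The effect of a substitution on the definition of a node. -/
def NodeDef.subst (σ : ℕ → Term) : NodeDef → NodeDef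
  | .closed p Xs => .closed p Xs
  | .opened F => .opened (F.subst σ)

/-- A configuration is a set of defining equations of nodes. The further conditions on configurations
(each node has one definition, sorts are respected, no variable has two occurrences in synthesized
positions) hold in initial configurations and are preserved by the application of productions. -/
abbrev Config : Type := Set (ℕ × NodeDef)

namespace Config

/-- The nodes of a configuration. -/
def nodes (Γ : Config) : Set ℕ := {X | ∃ D, (X, D) ∈ Γ}

/-- The variables of a configuration. -/
def vars (Γ : Config) : Set ℕ := {x | ∃ X F, (X, NodeDef.opened F) ∈ Γ ∧ x ∈ F.occ}

/-- A configuration is closed if it contains only closed nodes. -/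
def IsClosed (Γ : Config) : Prop := ∀ X F, (X, NodeDef.opened F) ∉ Γ

/-- The configuration `{X₀ = F}`. -/
def initial (F : Form) : Config := {(0, NodeDef.opened F)}

end Config

namespace Grammar

/-- `G.Fires p X Γ Γ'`: applying the production number `p` at the open node `X` transforms `Γ` into
`Γ'`. The variables of the production are first renamed injectively so as to be disjoint from those
of `Γ`, and the new nodes are arbitrary distinct nodes that are not in `Γ`. -/
def Fires (G : Grammar) (p X : ℕ) (Γ Γ' : Config) : Prop :=
  ∃ (P₀ P : Production) (ρ : ℕ → ℕ) (F : Form) (σ : Equations) (Xs : List ℕ),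
    G.prods[p]? = some P₀ ∧
    Function.Injective ρ ∧ P = P₀.rename ρ ∧ (∀ x ∈ P.occ, x ∉ Γ.vars) ∧
    (X, NodeDef.opened F) ∈ Γ ∧
    P.lhs.Matches F σ ∧
    Xs.length = P.rhs.length ∧ Xs.Nodup ∧ (∀ Y ∈ Xs, Y ∉ Γ.nodes) ∧
    Γ' = {(X, NodeDef.closed p Xs)} ∪
      {e | e ∈ Xs.zip (P.rhs.map fun F' => NodeDef.opened (F'.subst σ.toSubst))} ∪
      {e | ∃ X' D, (X', D) ∈ Γ ∧ X' ≠ X ∧ e = (X', D.subst σ.toSubst)}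

/-- `Γ'` is directly accessible from `Γ`. -/
def Step (G : Grammar) (Γ Γ' : Config) : Prop := ∃ p X, G.Fires p X Γ Γ'

/-- `Γ'` is accessible from `Γ`. -/
def Accessible (G : Grammar) : Config → Config → Prop := Relation.ReflTransGen G.Step

/-- A case: an instance of a service whose inherited attributes contain no variables besides the
variables in its synthesized positions, which are left unchanged. -/
def IsCase (G : Grammar) (c : Form) : Prop :=
  ∃ F ∈ G.services, ∃ (xs : List ℕ) (σ : ℕ → Term),
    F.syn = xs.map Term.var ∧ (∀ x ∈ xs, σ x = Term.var x) ∧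
    c = F.subst σ ∧
    ∀ t ∈ c.inh, t.Over G.ranks ∧ ∀ y ∈ t.occ, y ∈ xs

/-- Soundness: from every configuration that is accessible from the initial configuration of a case,
a closed configuration is accessible. -/
def Sound (G : Grammar) : Prop :=
  ∀ c, G.IsCase c → ∀ Γ, G.Accessible (Config.initial c) Γ →
    ∃ Γ', G.Accessible Γ Γ' ∧ Γ'.IsClosed

end Grammar

/-! ## The presentations of grammars as inputs of algorithms

Terms are numbered bijectively in the usual way by means of the pairing function; forms, productions
and grammars are tuples of lists of these. -/

namespace Term

mutual
/-- The number of a term. -/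
def toNat : Term → ℕ
  | .var x => 2 * x
  | .app c ts => 2 * Nat.pair c (listToNat ts) + 1
/-- The number of a list of terms. -/
def listToNat : List Term → ℕ
  | [] => 0
  | t :: ts => Nat.pair (toNat t) (listToNat ts) + 1
end

mutual
/-- The term with a given number. -/
def ofNat (n : ℕ) : Term :=
  if n % 2 = 0 then .var (n / 2)
  else .app (n / 2).unpair.1 (listOfNat (n / 2).unpair.2)
termination_by n
decreasing_by
  have := Nat.unpair_right_le (n / 2)
  omega
/-- The list of terms with a given number. -/
def listOfNat : ℕ → List Term
  | 0 => []
  | n + 1 => ofNat n.unpair.1 :: listOfNat n.unpair.2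
termination_by n => n
decreasing_by
  · have := Nat.unpair_left_le n
    omega
  · have := Nat.unpair_right_le n
    omega
end

mutual
theorem ofNat_toNat : ∀ t : Term, ofNat (toNat t) = t
  | .var x => by
    rw [toNat, ofNat]
    simp
  | .app c ts => by
    have h : (2 * Nat.pair c (listToNat ts) + 1) / 2 = Nat.pair c (listToNat ts) := by omega
    rw [toNat, ofNat, if_neg (by omega), h, Nat.unpair_pair, listOfNat_listToNat ts]
theorem listOfNat_listToNat : ∀ ts : List Term, listOfNat (listToNat ts) = ts
  | [] => by rw [listToNat, listOfNat]
  | t :: ts => by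
    rw [listToNat, listOfNat, Nat.unpair_pair, ofNat_toNat t, listOfNat_listToNat ts]
end

theorem toNat_ofNat_aux (n : ℕ) : toNat (ofNat n) = n ∧ listToNat (listOfNat n) = n := by
  induction n using Nat.strong_induction_on with
  | _ n ih =>
    constructor
    · rw [ofNat]
      split_ifs with h
      · rw [toNat]; omega
      · have h1 := Nat.unpair_right_le (n / 2)
        rw [toNat, (ih _ (by omega)).2, Nat.pair_unpair]
        omega
    · cases n with
      | zero => rw [listOfNat, listToNat]
      | succ n =>
        have h1 := Nat.unpair_left_le n
        have h2 := Nat.unpair_right_le n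
        rw [listOfNat, listToNat, (ih _ (by omega)).1, (ih _ (by omega)).2, Nat.pair_unpair]

/-- The numbering of terms. -/
def equivNat : Term ≃ ℕ := ⟨toNat, ofNat, ofNat_toNat, fun n => (toNat_ofNat_aux n).1⟩

instance : Primcodable Term := Primcodable.ofEquiv ℕ equivNat

end Term

/-- Forms as tuples. -/
def Form.equivProd : Form ≃ ℕ × List Term × List Term :=
  ⟨fun F => (F.sort, F.inh, F.syn), fun F => ⟨F.1, F.2.1, F.2.2⟩, fun _ => rfl, fun _ => rfl⟩

instance : Primcodable Form := Primcodable.ofEquiv _ Form.equivProd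

/-- Productions as pairs. -/
def Production.equivProd : Production ≃ Form × List Form :=
  ⟨fun P => (P.lhs, P.rhs), fun P => ⟨P.1, P.2⟩, fun _ => rfl, fun _ => rfl⟩

instance : Primcodable Production := Primcodable.ofEquiv _ Production.equivProd

/-- Grammars as tuples. -/
def Grammar.equivProd :
    Grammar ≃ List ℕ × List (ℕ × ℕ) × List Production × List Form :=
  ⟨fun G => (G.ranks, G.sorts, G.prods, G.services), fun G => ⟨G.1, G.2.1, G.2.2.1, G.2.2.2⟩,
    fun _ => rfl, fun _ => rfl⟩

instance : Primcodable Grammar := Primcodable.ofEquiv _ Grammar.equivProd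

end GuardedAttributeGrammar

/-!
The halting problem reduces to soundness, by grammars without synthesized attributes. In such a
grammar a configuration with a single open node `s(d₁, …, dₙ)⟨⟩` with closed data is a state of a
term rewriting system, and a production `s(p₁, …, pₙ)⟨⟩ ← s'(t₁, …, tₙ')⟨⟩` rewrites it at the root
by pattern matching: the equations for the synthesized attributes are vacuous, and applying a
production amounts to instantiating it (`Form.Matches.subst_eq`, `Form.matches_subst`).

A fixed list of nineteen productions, `machineProductions`, thus implements an abstract machine with
continuations for the programs `Turing.ToPartrec.Code`; programs, continuations and lists of numbers
are terms. The grammar `machineGrammar c n` has in addition one production that loads the program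
`c` and the input `n`. To every state some production applies, and every one that does leads to the
next state (`exists_lhs_subst`, `map_subst_rhs`); the production for returning a value to the empty
continuation has an empty right-hand side and closes the configuration. The only case of the
interface is the start state. By determinism a closed configuration is accessible from every
configuration of the run if and only if the machine stops, i.e. if and only if `c` has a value on
`[n]` (`sound_machineGrammar_iff`, `halts_start_iff`).

For a universal code `c`, the domain of `c` is undecidable (`exists_code_not_computablePred`), whereas
`n ↦ machineGrammar c n` is primitive recursive, since `n` enters only as a unary numeral
(`primrec_machineGrammar`). Hence soundness is undecidable.
-/

namespace GuardedAttributeGrammar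

/-! ### Substitution and matching -/

namespace Term

mutual
theorem subst_var : ∀ t : Term, t.subst var = t
  | .var x => by rw [subst]
  | .app c ts => by rw [subst, substList_var ts]
theorem substList_var : ∀ ts : List Term, substList var ts = ts
  | [] => by rw [substList]
  | t :: ts => by rw [substList, subst_var t, substList_var ts]
end

mutual
theorem subst_subst (σ τ : ℕ → Term) :
    ∀ t : Term, (t.subst σ).subst τ = t.subst fun x => (σ x).subst τ
  | .var x => by simp only [subst]
  | .app c ts => by simp only [subst, substList_substList σ τ ts]
theorem substList_substList (σ τ : ℕ → Term) :
    ∀ ts : List Term,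
      substList τ (substList σ ts) = substList (fun x => (σ x).subst τ) ts
  | [] => by simp only [substList]
  | t :: ts => by simp only [substList, subst_subst σ τ t, substList_substList σ τ ts]
end

mutual
theorem occ_subst_rename (ρ : ℕ → ℕ) :
    ∀ t : Term, (t.subst fun x => var (ρ x)).occ = t.occ.map ρ
  | .var x => by simp only [subst, occ, List.map]
  | .app c ts => by simp only [subst, occ, occList_substList_rename ρ ts]
theorem occList_substList_rename (ρ : ℕ → ℕ) :
    ∀ ts : List Term, occList (substList (fun x => var (ρ x)) ts) = (occList ts).map ρ
  | [] => by simp only [substList, occList, List.map]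
  | t :: ts => by
    simp only [substList, occList, List.map_append, occ_subst_rename ρ t,
      occList_substList_rename ρ ts]
end

mutual
/-- Matching a pattern with one of its instances succeeds and returns the instantiating
substitution, restricted to the variables of the pattern. -/
theorem matching_subst (τ : ℕ → Term) :
    ∀ p : Term, matching p (p.subst τ) = some (p.occ.map fun x => (x, τ x))
  | .var x => by simp [subst, matching, occ]
  | .app c ps => by simp [subst, matching, occ, matchingList_substList τ ps]
theorem matchingList_substList (τ : ℕ → Term) :
    ∀ ps : List Term,
      matchingList ps (substList τ ps) = some ((occList ps).map fun x => (x, τ x))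
  | [] => by simp [substList, matchingList, occList]
  | p :: ps => by
    simp [substList, matchingList, occList, matching_subst τ p, matchingList_substList τ ps]
end

mutual
theorem dom_matching : ∀ (p d : Term) (E : Equations), matching p d = some E → E.dom = p.occ
  | .var x, d, E, h => by
    simp only [matching, Option.some.injEq] at h
    subst h
    simp [Equations.dom, occ]
  | .app c ps, .var y, E, h => by simp [matching] at h
  | .app c ps, .app c' ds, E, h => by
    simp only [matching] at h
    split_ifs at h
    rw [occ]
    exact dom_matchingList ps ds E h
theorem dom_matchingList : ∀ (ps ds : List Term) (E : Equations),
    matchingList ps ds = some E → E.dom = occList ps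
  | [], [], E, h => by
    simp only [matchingList, Option.some.injEq] at h
    subst h
    simp [Equations.dom, occList]
  | [], d :: ds, E, h => by simp [matchingList] at h
  | p :: ps, [], E, h => by simp [matchingList] at h
  | p :: ps, d :: ds, E, h => by
    simp only [matchingList] at h
    split at h
    · rename_i E₁ E₂ h₁ h₂
      simp only [Option.some.injEq] at h
      subst h
      have e₁ := dom_matching p d E₁ h₁
      have e₂ := dom_matchingList ps ds E₂ h₂
      simp only [Equations.dom] at e₁ e₂
      simp [Equations.dom, occList, e₁, e₂]
    · simp at h
end

mutual
/-- The solution of a matching problem instantiates the pattern to the data. -/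
theorem subst_of_matching (τ : ℕ → Term) : ∀ (p d : Term) (E : Equations),
    matching p d = some E → (∀ e ∈ E, τ e.1 = e.2) → p.subst τ = d
  | .var x, d, E, h, hτ => by
    simp only [matching, Option.some.injEq] at h
    subst h
    simpa [subst] using hτ
  | .app c ps, .var y, E, h, _ => by simp [matching] at h
  | .app c ps, .app c' ds, E, h, hτ => by
    simp only [matching] at h
    split_ifs at h with hc
    rw [subst, substList_of_matchingList τ ps ds E h hτ, hc]
theorem substList_of_matchingList (τ : ℕ → Term) : ∀ (ps ds : List Term) (E : Equations),
    matchingList ps ds = some E → (∀ e ∈ E, τ e.1 = e.2) → substList τ ps = ds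
  | [], [], E, h, _ => by simp [substList]
  | [], d :: ds, E, h, _ => by simp [matchingList] at h
  | p :: ps, [], E, h, _ => by simp [matchingList] at h
  | p :: ps, d :: ds, E, h, hτ => by
    simp only [matchingList] at h
    split at h
    · rename_i E₁ E₂ h₁ h₂
      simp only [Option.some.injEq] at h
      subst h
      rw [substList, subst_of_matching τ p d E₁ h₁ fun e he => hτ e (List.mem_append_left _ he),
        substList_of_matchingList τ ps ds E₂ h₂ fun e he => hτ e (List.mem_append_right _ he)]
    · simp at h
end

theorem over_var_iff (ranks : List ℕ) (x : ℕ) : (var x).Over ranks ↔ True :=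
  ⟨fun _ => trivial, fun _ => .var x⟩

theorem over_app_iff (ranks : List ℕ) (c : ℕ) (ts : List Term) :
    (app c ts).Over ranks ↔ ranks[c]? = some ts.length ∧ ∀ t ∈ ts, t.Over ranks := by
  refine ⟨fun h => ?_, fun h => .app c ts h.1 h.2⟩
  cases h with
  | app _ _ hc hts => exact ⟨hc, hts⟩

end Term

theorem Equations.toSubst_of_mem {E : Equations} (hE : E.dom.Nodup) :
    ∀ e ∈ E, E.toSubst e.1 = e.2 := by
  induction E with
  | nil => simp
  | cons a E ih =>
    obtain ⟨k, t⟩ := a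
    simp only [Equations.dom, List.map_cons, List.nodup_cons] at hE
    intro e he
    rcases List.mem_cons.1 he with rfl | he
    · simp [Equations.toSubst]
    · have hne : e.1 ≠ k := fun h => hE.1 (h ▸ List.mem_map_of_mem he)
      have := ih hE.2 e he
      simpa [Equations.toSubst, List.lookup_cons, beq_false_of_ne hne] using this

namespace Equations

theorem toSubst_nil : toSubst [] = Term.var := by
  funext x
  simp [toSubst]

theorem eq_nil_of_isSolvedForm_nil {E : Equations} (h : IsSolvedForm [] E) : E = [] := by
  obtain ⟨⟨n, hn⟩, -⟩ := h
  rw [hn]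
  exact Function.iterate_fixed (by simp [substRhs]) n

theorem isSolvedForm_nil : IsSolvedForm [] [] := ⟨⟨0, rfl⟩, by simp⟩

theorem acyclic_nil : Acyclic [] := by
  intro x h
  obtain ⟨y, ⟨t, ht, -⟩, -⟩ := Relation.TransGen.head'_iff.1 h
  simp at ht

theorem substRhs_var (E : Equations) : E.substRhs Term.var = E := by
  simp [substRhs, Term.subst_var]

end Equations

namespace Form

theorem subst_var (F : Form) : F.subst Term.var = F := by
  simp [subst, Term.substList_var]

theorem subst_subst (σ τ : ℕ → Term) (F : Form) :
    (F.subst σ).subst τ = F.subst fun x => (σ x).subst τ := by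
  simp [subst, Term.substList_substList]

/-- Without synthesized attributes there is no system of equations to solve, and a linear form
matches only with its instances. -/
theorem Matches.subst_eq {F F' : Form} {σ : Equations} (h : F.Matches F' σ) (hsyn : F.syn = [])
    (hlin : (Term.occList F.inh).Nodup) : F.subst σ.toSubst = F' := by
  obtain ⟨hsort, ys, σin, σout, hys, hlen, hin, -, hout, rfl⟩ := h
  obtain rfl : ys = [] := List.eq_nil_of_length_eq_zero (by rw [← hlen, hsyn, List.length_nil])
  obtain rfl := Equations.eq_nil_of_isSolvedForm_nil hout
  rw [Equations.toSubst_nil, Equations.substRhs_var, List.nil_append]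
  have hdom := Term.dom_matchingList _ _ _ hin
  have := Term.substList_of_matchingList σin.toSubst _ _ _ hin
    (Equations.toSubst_of_mem (hdom ▸ hlin))
  cases F'
  simp_all [subst, Term.substList]

/-- A form without synthesized attributes matches with all its instances. -/
theorem matches_subst {F : Form} (hsyn : F.syn = []) (τ : ℕ → Term) :
    F.Matches (F.subst τ) ((Term.occList F.inh).map fun x => (x, τ x)) := by
  refine ⟨rfl, [], _, [], ?_, ?_, Term.matchingList_substList τ F.inh, ?_, ?_, ?_⟩
  · simp [subst, hsyn, Term.substList]
  · simp [hsyn]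
  · exact Equations.acyclic_nil
  · exact Equations.isSolvedForm_nil
  · rw [Equations.toSubst_nil, Equations.substRhs_var, List.nil_append]

end Form

theorem Production.rename_id (P : Production) : P.rename id = P := by
  cases P
  simp [rename, Form.subst_var]

open Turing.ToPartrec (Code Cont Cfg stepNormal stepRet)

/-! ### Small steps of the evaluation of codes -/

/-- The states of a machine that evaluates a `Code` on a list of natural numbers: a start state, the
evaluation of a code on a list inside a continuation, and the return of a list to a continuation. -/
inductive State : Type
  | start : State
  | norm (c : Code) (k : Cont) (v : List ℕ) : State
  | ret (k : Cont) (v : List ℕ) : State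

/-- The next state of the machine that evaluates `c₀` on `[n]`, and `none` if it stops. The recursive
calls in `Turing.ToPartrec.stepNormal` and `Turing.ToPartrec.stepRet` are steps of this machine, and
the tests on the first entry of a list are pattern matchings. -/
def State.next (c₀ : Code) (n : ℕ) : State → Option State
  | .start => some (.norm c₀ .halt [n])
  | .norm .zero' k v => some (.ret k (0 :: v))
  | .norm .succ k [] => some (.ret k [1])
  | .norm .succ k (x :: _) => some (.ret k [x + 1])
  | .norm .tail k [] => some (.ret k [])
  | .norm .tail k (_ :: v) => some (.ret k v)
  | .norm (.cons f fs) k v => some (.norm f (.cons₁ fs v k) v)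
  | .norm (.comp f g) k v => some (.norm g (.comp f k) v)
  | .norm (.case f _) k [] => some (.norm f k [])
  | .norm (.case f _) k (0 :: v) => some (.norm f k v)
  | .norm (.case _ g) k ((x + 1) :: v) => some (.norm g k (x :: v))
  | .norm (.fix f) k v => some (.norm f (.fix f k) v)
  | .ret .halt _ => none
  | .ret (.cons₁ fs as k) v => some (.norm fs (.cons₂ v k) as)
  | .ret (.cons₂ [] k) v => some (.ret k (0 :: v))
  | .ret (.cons₂ (x :: _) k) v => some (.ret k (x :: v))
  | .ret (.comp f k) v => some (.norm f k v)
  | .ret (.fix _ k) [] => some (.ret k [])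
  | .ret (.fix _ k) (0 :: v) => some (.ret k v)
  | .ret (.fix f k) ((_ + 1) :: v) => some (.norm f (.fix f k) v)

/-- The machine that evaluates `c₀` on `[n]` stops after finitely many steps; it has stopped in
`none`. -/
inductive Halts (c₀ : Code) (n : ℕ) : Option State → Prop
  | none : Halts c₀ n none
  | some (s : State) (h : Halts c₀ n (s.next c₀ n)) : Halts c₀ n (some s)

/-- A state as a configuration of `Turing.ToPartrec.step`. The start state has the configuration of
its successor, and the stopped machine an arbitrary final one. -/
def toCfg (c₀ : Code) (n : ℕ) : Option State → Cfg
  | none => .halt []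
  | some .start => stepNormal c₀ .halt [n]
  | some (.norm c k v) => stepNormal c k v
  | some (.ret k v) => stepRet k v

/-- A step of a running machine either keeps the configuration of `Turing.ToPartrec.step` or advances
it by one step. -/
theorem Halts.dom_eval {c₀ : Code} {n : ℕ} {o : Option State} (h : Halts c₀ n o) :
    (StateTransition.eval Turing.ToPartrec.step (toCfg c₀ n o)).Dom := by
  have hhalt : ∀ v, (StateTransition.eval Turing.ToPartrec.step (.halt v)).Dom := fun v =>
    Part.dom_iff_mem.2 ⟨_, StateTransition.mem_eval.2 ⟨Relation.ReflTransGen.refl, rfl⟩⟩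
  have hret : ∀ k v, (StateTransition.eval Turing.ToPartrec.step (stepRet k v)).Dom →
      (StateTransition.eval Turing.ToPartrec.step (.ret k v)).Dom := fun k v h => by
    rwa [StateTransition.reaches_eval (Relation.ReflTransGen.single rfl :
      StateTransition.Reaches Turing.ToPartrec.step (.ret k v) (stepRet k v))]
  induction h with
  | none => exact hhalt _
  | some s h ih =>
    rcases s with _ | ⟨_ | _ | _ | _ | _ | _ | _, k, _ | ⟨_ | _, _⟩⟩ |
      ⟨_ | _ | ⟨_ | _, _⟩ | _ | _, _ | ⟨_ | _, _⟩⟩ <;>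
    first
    | exact ih
    | exact hret _ _ ih
    | exact hhalt _

/-- The machine stops when it is started at the given configuration of `Turing.ToPartrec.step`, where
`Cfg.ret k v` is the state that returns `v` to `k`. -/
def CfgHalts (c₀ : Code) (n : ℕ) : Cfg → Prop
  | .halt _ => True
  | .ret k v => Halts c₀ n (some (.ret k v))

/-- The recursive calls of `stepNormal` are steps of the machine; structural induction on the code
shows that they end at the configuration `stepNormal c k v`. -/
theorem halts_norm {c₀ : Code} {n : ℕ} (c : Code) (k : Cont) (v : List ℕ)
    (h : CfgHalts c₀ n (stepNormal c k v)) : Halts c₀ n (some (.norm c k v)) := by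
  induction c generalizing k v with
  | zero' => exact .some _ h
  | succ => cases v <;> exact .some _ h
  | tail => cases v <;> exact .some _ h
  | cons f fs ihf ihfs => exact .some _ (ihf _ _ h)
  | comp f g ihf ihg => exact .some _ (ihg _ _ h)
  | case f g ihf ihg =>
    rcases v with _ | ⟨_ | x, v⟩
    · exact .some _ (ihf _ _ h)
    · exact .some _ (ihf _ _ h)
    · exact .some _ (ihg _ _ h)
  | fix f ih => exact .some _ (ih _ _ h)

/-- The recursive calls of `stepRet` are steps of the machine; structural induction on the
continuation shows that they end at the configuration `stepRet k v`. -/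
theorem halts_ret {c₀ : Code} {n : ℕ} (k : Cont) (v : List ℕ)
    (h : CfgHalts c₀ n (stepRet k v)) : Halts c₀ n (some (.ret k v)) := by
  induction k generalizing v with
  | halt => exact .some _ .none
  | cons₁ fs as k ih => exact .some _ (halts_norm _ _ _ h)
  | cons₂ ns k ih => cases ns <;> exact .some _ (ih _ h)
  | comp f k ih => exact .some _ (halts_norm _ _ _ h)
  | fix f k ih =>
    rcases v with _ | ⟨_ | x, v⟩
    · exact .some _ (ih _ h)
    · exact .some _ (ih _ h)
    · exact .some _ (halts_norm _ _ _ h)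

theorem halts_start_iff (c : Code) (n : ℕ) :
    Halts c n (some .start) ↔ (c.eval [n]).Dom := by
  have heval : (StateTransition.eval Turing.ToPartrec.step (stepNormal c .halt [n])).Dom ↔
      (c.eval [n]).Dom := by
    rw [Turing.ToPartrec.stepNormal_eval]
    rfl
  rw [← heval]
  refine ⟨fun h => h.dom_eval, fun h => .some _ (halts_norm _ _ _ ?_)⟩
  obtain ⟨b, hb⟩ := Part.dom_iff_mem.1 h
  refine StateTransition.evalInduction hb fun a _ ih => ?_
  cases a with
  | halt v => trivial
  | ret k v => exact halts_ret k v (ih _ rfl)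

/-! ### The rewriting rules of the machine as productions -/

namespace Term

/-- The term for `0`. -/
abbrev zero : Term := app 0 []
/-- The term for the successor of a number. -/
abbrev succ (t : Term) : Term := app 1 [t]
/-- The term for the empty list. -/
abbrev nil : Term := app 2 []
/-- The term for a list with a given head and tail. -/
abbrev cons (t l : Term) : Term := app 3 [t, l]

/-- The unary numeral of a natural number. -/
def ofNum : ℕ → Term
  | 0 => zero
  | n + 1 => succ (ofNum n)

/-- The term for a list of natural numbers. -/
def ofNums : List ℕ → Term
  | [] => nil
  | n :: v => cons (ofNum n) (ofNums v)

/-- The term for a code. -/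
def ofCode : Code → Term
  | .zero' => app 4 []
  | .succ => app 5 []
  | .tail => app 6 []
  | .cons f fs => app 7 [ofCode f, ofCode fs]
  | .comp f g => app 8 [ofCode f, ofCode g]
  | .case f g => app 9 [ofCode f, ofCode g]
  | .fix f => app 10 [ofCode f]

/-- The term for a continuation. -/
def ofCont : Cont → Term
  | .halt => app 11 []
  | .cons₁ fs as k => app 12 [ofCode fs, ofNums as, ofCont k]
  | .cons₂ ns k => app 13 [ofNums ns, ofCont k]
  | .comp f k => app 14 [ofCode f, ofCont k]
  | .fix f k => app 15 [ofCode f, ofCont k]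

end Term

/-- The ranks of the symbols used for numbers, lists, codes and continuations. -/
abbrev machineRanks : List ℕ := [0, 1, 0, 2, 0, 0, 0, 2, 2, 2, 1, 0, 3, 2, 2, 2]

/-- The sorts of the start state, of the evaluation of a code and of the return to a continuation.
None has synthesized attributes. -/
abbrev machineSorts : List (ℕ × ℕ) := [(0, 0), (3, 0), (2, 0)]

namespace Form

/-- The form of the start state. -/
abbrev start : Form := ⟨0, [], []⟩
/-- The form of the evaluation of a code in a continuation on a list. -/
abbrev norm (c k v : Term) : Form := ⟨1, [c, k, v], []⟩
/-- The form of the return of a list to a continuation. -/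
abbrev ret (k v : Term) : Form := ⟨2, [k, v], []⟩

end Form

/-- The form that represents a state. -/
def State.form : State → Form
  | .start => .start
  | .norm c k v => .norm (.ofCode c) (.ofCont k) (.ofNums v)
  | .ret k v => .ret (.ofCont k) (.ofNums v)

/-- The production for the first step of the machine that evaluates `c` on `[n]`. -/
def startProduction (c : Code) (n : ℕ) : Production :=
  ⟨.start, [.norm (.ofCode c) (.app 11 []) (.cons (.ofNum n) .nil)]⟩

open Term in
/-- The productions for the steps of the machine other than the first one. -/
def machineProductions : List Production :=
  let x := var 0
  let v := var 1
  let k := var 2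
  let f := var 3
  let g := var 4
  let w := var 5
  [
    -- evaluation of `zero'`, `succ`, `tail`, `cons`, `comp`, `case`, `fix`
    ⟨.norm (app 4 []) k v, [.ret k (cons zero v)]⟩,
    ⟨.norm (app 5 []) k nil, [.ret k (cons (succ zero) nil)]⟩,
    ⟨.norm (app 5 []) k (cons x v), [.ret k (cons (succ x) nil)]⟩,
    ⟨.norm (app 6 []) k nil, [.ret k nil]⟩,
    ⟨.norm (app 6 []) k (cons x v), [.ret k v]⟩,
    ⟨.norm (app 7 [f, g]) k v, [.norm f (app 12 [g, v, k]) v]⟩,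
    ⟨.norm (app 8 [f, g]) k v, [.norm g (app 14 [f, k]) v]⟩,
    ⟨.norm (app 9 [f, g]) k nil, [.norm f k nil]⟩,
    ⟨.norm (app 9 [f, g]) k (cons zero v), [.norm f k v]⟩,
    ⟨.norm (app 9 [f, g]) k (cons (succ x) v), [.norm g k (cons x v)]⟩,
    ⟨.norm (app 10 [f]) k v, [.norm f (app 15 [f, k]) v]⟩,
    -- return to `halt`, `cons₁`, `cons₂`, `comp`, `fix`
    ⟨.ret (app 11 []) v, []⟩,
    ⟨.ret (app 12 [f, w, k]) v, [.norm f (app 13 [v, k]) w]⟩,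
    ⟨.ret (app 13 [nil, k]) v, [.ret k (cons zero v)]⟩,
    ⟨.ret (app 13 [cons x w, k]) v, [.ret k (cons x v)]⟩,
    ⟨.ret (app 14 [f, k]) v, [.norm f k v]⟩,
    ⟨.ret (app 15 [f, k]) nil, [.ret k nil]⟩,
    ⟨.ret (app 15 [f, k]) (cons zero v), [.ret k v]⟩,
    ⟨.ret (app 15 [f, k]) (cons (succ x) v), [.norm f (app 15 [f, k]) v]⟩]

/-- The grammar of the machine that evaluates `c` on `[n]`. Its only service is the start state. -/
def machineGrammar (c : Code) (n : ℕ) : Grammar :=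
  ⟨machineRanks, machineSorts, startProduction c n :: machineProductions, [.start]⟩

namespace Term

theorem subst_ofNum (σ : ℕ → Term) (n : ℕ) : (ofNum n).subst σ = ofNum n := by
  induction n with
  | zero => simp [ofNum, subst, substList]
  | succ n ih => simp [ofNum, subst, substList, ih]

theorem subst_ofCode (σ : ℕ → Term) (c : Code) : (ofCode c).subst σ = ofCode c := by
  induction c <;> simp_all [ofCode, subst, substList]

theorem occ_ofNum (n : ℕ) : (ofNum n).occ = [] := by
  induction n with
  | zero => simp [ofNum, occ, occList]
  | succ n ih => simp [ofNum, occ, occList, ih]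

theorem occ_ofNums (v : List ℕ) : (ofNums v).occ = [] := by
  induction v with
  | nil => simp [ofNums, occ, occList]
  | cons n v ih => simp [ofNums, occ, occList, occ_ofNum, ih]

theorem occ_ofCode (c : Code) : (ofCode c).occ = [] := by
  induction c <;> simp_all [ofCode, occ, occList]

theorem occ_ofCont (k : Cont) : (ofCont k).occ = [] := by
  induction k <;> simp_all [ofCont, occ, occList, occ_ofCode, occ_ofNums]

theorem over_ofNum (n : ℕ) : (ofNum n).Over machineRanks := by
  induction n with
  | zero => simp [ofNum, over_app_iff]
  | succ n ih => simp [ofNum, over_app_iff, ih]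

theorem over_ofCode (c : Code) : (ofCode c).Over machineRanks := by
  induction c <;> simp_all [ofCode, over_app_iff]

end Term

theorem State.occ_form (s : State) : s.form.occ = [] := by
  cases s <;>
    simp [State.form, Form.occ, Term.occList, Term.occ_ofCode, Term.occ_ofCont, Term.occ_ofNums]

/-! ### The productions simulate the machine -/

/-- Every production that applies to a state leads to its next state. -/
theorem map_subst_rhs {c : Code} {n : ℕ} {P : Production} (hP : P ∈ (machineGrammar c n).prods)
    {s : State} {τ : ℕ → Term} (h : P.lhs.subst τ = s.form) :
    P.rhs.map (fun F => F.subst τ) = (s.next c n).toList.map State.form := by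
  simp only [machineGrammar, machineProductions, List.mem_cons, List.not_mem_nil, or_false] at hP
  rcases hP with rfl | rfl | rfl | rfl | rfl | rfl | rfl | rfl | rfl | rfl | rfl | rfl | rfl |
    rfl | rfl | rfl | rfl | rfl | rfl | rfl
  all_goals
    rcases s with _ | ⟨c, k, v⟩ | ⟨k, v⟩ <;>
      simp only [startProduction, State.form, Form.subst, Term.subst, Term.substList, Form.mk.injEq,
        List.cons.injEq, and_true, true_and, false_and, zero_ne_one, one_ne_zero,
        OfNat.ofNat_ne_zero, OfNat.zero_ne_ofNat, OfNat.ofNat_ne_one, OfNat.one_ne_ofNat] at h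
  · simp [startProduction, State.form, State.next, Form.subst, Term.subst, Term.substList,
      Term.ofNums, Term.ofCont, Term.subst_ofNum, Term.subst_ofCode]
  -- the outermost symbols of the pattern determine the shape of the state
  all_goals
    first
    | cases c <;> simp only [Term.ofCode, Term.app.injEq, Nat.reduceEqDiff, false_and] at h
    | cases k <;> simp only [Term.ofCont, Term.app.injEq, Nat.reduceEqDiff, false_and] at h
  all_goals
    first
    | simp_all [State.form, State.next, Form.subst, Term.subst, Term.substList, Term.ofNum,
        Term.ofNums, Term.ofCont]; done
    | rcases v with _ | ⟨_ | x, v⟩ <;>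
      simp_all [State.form, State.next, Form.subst, Term.subst, Term.substList, Term.ofNum,
        Term.ofNums, Term.ofCont]; done
    | rename_i ns _
      cases ns <;>
      simp_all [State.form, State.next, Form.subst, Term.subst, Term.substList, Term.ofNum,
        Term.ofNums]

/-- Some production applies to every state. -/
theorem exists_lhs_subst (c : Code) (n : ℕ) (s : State) :
    ∃ P ∈ (machineGrammar c n).prods, ∃ τ, P.lhs.subst τ = s.form := by
  have key (i : Fin 19) (x v k f g w : Term)
      (h : (machineProductions[i]).lhs.subst (fun j => [x, v, k, f, g, w].getD j .nil) = s.form) :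
      ∃ P ∈ (machineGrammar c n).prods, ∃ τ, P.lhs.subst τ = s.form :=
    ⟨_, List.mem_cons_of_mem _ (List.getElem_mem _), _, h⟩
  let o := Term.nil
  match s with
  | .start => exact ⟨startProduction c n, List.mem_cons_self, Term.var, rfl⟩
  | .norm .zero' k v => exact key 0 o (.ofNums v) (.ofCont k) o o o rfl
  | .norm .succ k [] => exact key 1 o o (.ofCont k) o o o rfl
  | .norm .succ k (x :: v) => exact key 2 (.ofNum x) (.ofNums v) (.ofCont k) o o o rfl
  | .norm .tail k [] => exact key 3 o o (.ofCont k) o o o rfl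
  | .norm .tail k (x :: v) => exact key 4 (.ofNum x) (.ofNums v) (.ofCont k) o o o rfl
  | .norm (.cons f g) k v => exact key 5 o (.ofNums v) (.ofCont k) (.ofCode f) (.ofCode g) o rfl
  | .norm (.comp f g) k v => exact key 6 o (.ofNums v) (.ofCont k) (.ofCode f) (.ofCode g) o rfl
  | .norm (.case f g) k [] => exact key 7 o o (.ofCont k) (.ofCode f) (.ofCode g) o rfl
  | .norm (.case f g) k (0 :: v) =>
    exact key 8 o (.ofNums v) (.ofCont k) (.ofCode f) (.ofCode g) o rfl
  | .norm (.case f g) k ((x + 1) :: v) =>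
    exact key 9 (.ofNum x) (.ofNums v) (.ofCont k) (.ofCode f) (.ofCode g) o rfl
  | .norm (.fix f) k v => exact key 10 o (.ofNums v) (.ofCont k) (.ofCode f) o o rfl
  | .ret .halt v => exact key 11 o (.ofNums v) o o o o rfl
  | .ret (.cons₁ f w k) v =>
    exact key 12 o (.ofNums v) (.ofCont k) (.ofCode f) o (.ofNums w) rfl
  | .ret (.cons₂ [] k) v => exact key 13 o (.ofNums v) (.ofCont k) o o o rfl
  | .ret (.cons₂ (x :: w) k) v =>
    exact key 14 (.ofNum x) (.ofNums v) (.ofCont k) o o (.ofNums w) rfl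
  | .ret (.comp f k) v => exact key 15 o (.ofNums v) (.ofCont k) (.ofCode f) o o rfl
  | .ret (.fix f k) [] => exact key 16 o o (.ofCont k) (.ofCode f) o o rfl
  | .ret (.fix f k) (0 :: v) => exact key 17 o (.ofNums v) (.ofCont k) (.ofCode f) o o rfl
  | .ret (.fix f k) ((x + 1) :: v) =>
    exact key 18 (.ofNum x) (.ofNums v) (.ofCont k) (.ofCode f) o o rfl

theorem wellFormed_machineGrammar (c : Code) (n : ℕ) : (machineGrammar c n).WellFormed := by
  refine ⟨?_, ?_⟩
  · simp [machineGrammar, startProduction, machineProductions, Production.WellFormed,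
      Production.inputOcc, Form.Over, Term.over_app_iff, Term.over_var_iff, Term.occList, Term.occ,
      Term.over_ofCode, Term.over_ofNum]
  · simp [machineGrammar, Form.Over, Form.IsServiceCall]

theorem syn_eq_nil {c : Code} {n : ℕ} {P : Production} (hP : P ∈ (machineGrammar c n).prods) :
    P.lhs.syn = [] := by
  revert P
  simp [machineGrammar, startProduction, machineProductions]

/-! ### Configurations of the grammar and runs of the machine -/

/-- A configuration represents a state if it has exactly one open node, and this node carries the
form of the state. It represents the stopped machine `none` if it is closed. Only finitely many nodes
are in use, so that there are always new ones. -/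
def Represents (Γ : Config) (o : Option State) : Prop :=
  Γ.nodes.Finite ∧ ∃ X, ∀ Y F, (Y, NodeDef.opened F) ∈ Γ ↔ Y = X ∧ ∃ s ∈ o, F = s.form

theorem represents_initial : Represents (Config.initial .start) (some .start) := by
  refine ⟨(Set.finite_singleton 0).subset ?_, 0, ?_⟩
  · rintro X ⟨D, hD⟩
    exact congrArg Prod.fst hD
  · simp [Config.initial, State.form]

theorem Represents.isClosed_iff {Γ : Config} {o : Option State} (h : Represents Γ o) :
    Γ.IsClosed ↔ o = none := by
  obtain ⟨-, X, hX⟩ := h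
  cases o with
  | none => simp [Config.IsClosed, hX]
  | some s => simp [Config.IsClosed, hX]

theorem Represents.fires {c : Code} {n p X : ℕ} {Γ Γ' : Config} {s : State}
    (h : Represents Γ (some s)) (hf : (machineGrammar c n).Fires p X Γ Γ') :
    Represents Γ' (s.next c n) := by
  obtain ⟨hfin, X₀, hopen⟩ := h
  obtain ⟨P₀, P, ρ, F, σ, Xs, hp, hρ, rfl, -, hX, hmatch, hlen, -, -, rfl⟩ := hf
  obtain ⟨rfl, s', hs', rfl⟩ := (hopen _ _).1 hX
  cases hs'
  have hP := List.mem_of_getElem? hp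
  have hsyn : (P₀.rename ρ).lhs.syn = [] := by
    simp [Production.rename, Form.subst, syn_eq_nil hP, Term.substList]
  have hlin : (Term.occList (P₀.rename ρ).lhs.inh).Nodup := by
    have := ((wellFormed_machineGrammar c n).1 _ hP).2.2
    rw [Production.inputOcc, List.nodup_append] at this
    simp only [Production.rename, Form.subst, Term.occList_substList_rename]
    exact this.1.map hρ
  have hlhs := hmatch.subst_eq hsyn hlin
  simp only [Production.rename, Form.subst_subst, Term.subst] at hlhs
  have hrhs := map_subst_rhs hP hlhs
  have hnew : ((P₀.rename ρ).rhs.map fun F' => NodeDef.opened (F'.subst σ.toSubst)) =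
      (s.next c n).toList.map fun s' => NodeDef.opened s'.form := by
    have := congrArg (List.map NodeDef.opened) hrhs
    simpa [Production.rename, Form.subst_subst, Term.subst, Function.comp_def] using this
  have hlen' : Xs.length = (s.next c n).toList.length := by
    rw [hlen]
    simpa using congrArg List.length hnew
  rw [hnew]
  constructor
  · refine ((hfin.insert X).union Xs.finite_toSet).subset ?_
    rintro Y ⟨D, (hD | hD) | ⟨Z, D', hD', -, hD⟩⟩
    · exact .inl (.inl (congrArg Prod.fst hD))
    · exact .inr (List.of_mem_zip hD).1
    · exact .inl (.inr ⟨D', by rwa [show Y = Z from congrArg Prod.fst hD]⟩)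
  · have hold : ∀ Y F, ¬ ∃ X' D, (X', D) ∈ Γ ∧ X' ≠ X ∧
        (Y, NodeDef.opened F) = (X', NodeDef.subst σ.toSubst D) := by
      rintro Y F ⟨X', D, hD, hne, he⟩
      cases D with
      | closed q Ys => cases he
      | opened F' => exact hne ((hopen _ _).1 hD).1
    cases hnext : s.next c n with
    | none =>
      refine ⟨0, fun Y F => ?_⟩
      simpa using hold Y F
    | some s' =>
      rw [hnext] at hlen'
      obtain ⟨Y₀, rfl⟩ := List.length_eq_one_iff.1 hlen'
      refine ⟨Y₀, fun Y F => ?_⟩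
      simp only [Set.mem_union, Set.mem_ofPred_eq, hold Y F]
      simp

theorem Represents.exists_step (c : Code) (n : ℕ) {Γ : Config} {s : State}
    (h : Represents Γ (some s)) : ∃ Γ', (machineGrammar c n).Step Γ Γ' := by
  obtain ⟨hfin, X, hopen⟩ := h
  obtain ⟨P, hP, τ, hτ⟩ := exists_lhs_subst c n s
  obtain ⟨p, hp⟩ := List.mem_iff_getElem?.1 hP
  obtain ⟨N, hN⟩ := hfin.bddAbove
  have hmatch := Form.matches_subst (syn_eq_nil hP) τ
  rw [hτ] at hmatch
  refine ⟨_, p, X, P, P, id, s.form, _, (List.range P.rhs.length).map (N + 1 + ·), hp,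
    Function.injective_id, P.rename_id.symm, ?_, (hopen _ _).2 ⟨rfl, s, rfl, rfl⟩, hmatch,
    by simp, ?_, ?_, rfl⟩
  · -- the data contain no variables, hence no renaming is necessary
    rintro x - ⟨Y, F, hF, hx⟩
    obtain ⟨-, s', -, rfl⟩ := (hopen _ _).1 hF
    simp [s'.occ_form] at hx
  · exact List.nodup_range.map (add_right_injective _)
  · intro Y hY hmem
    obtain ⟨i, -, rfl⟩ := List.mem_map.1 hY
    have := hN hmem
    omega

theorem Represents.of_step {c : Code} {n : ℕ} {Γ Γ' : Config} {o : Option State}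
    (h : Represents Γ o) (hs : (machineGrammar c n).Step Γ Γ') :
    ∃ s, o = some s ∧ Represents Γ' (s.next c n) := by
  obtain ⟨p, X, hf⟩ := hs
  cases o with
  | none =>
    obtain ⟨-, -, -, F, -, -, -, -, -, -, hX, -⟩ := hf
    exact absurd hX (h.isClosed_iff.2 rfl X F)
  | some s => exact ⟨s, rfl, h.fires hf⟩

theorem Represents.exists_isClosed {c : Code} {n : ℕ} {o : Option State} (ho : Halts c n o)
    {Γ : Config} (h : Represents Γ o) :
    ∃ Γ', (machineGrammar c n).Accessible Γ Γ' ∧ Γ'.IsClosed := by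
  induction ho generalizing Γ with
  | none => exact ⟨Γ, .refl, h.isClosed_iff.2 rfl⟩
  | some s _ ih =>
    obtain ⟨Γ₁, hstep⟩ := h.exists_step c n
    obtain ⟨s', hs', h₁⟩ := h.of_step hstep
    cases hs'
    obtain ⟨Γ', hacc, hclosed⟩ := ih h₁
    exact ⟨Γ', .head hstep hacc, hclosed⟩

theorem Represents.halts {c : Code} {n : ℕ} {Γ Γ' : Config}
    (hacc : (machineGrammar c n).Accessible Γ Γ') (hclosed : Γ'.IsClosed) {o : Option State}
    (h : Represents Γ o) : Halts c n o := by
  induction hacc using Relation.ReflTransGen.head_induction_on generalizing o with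
  | refl =>
    rw [h.isClosed_iff.1 hclosed]
    exact .none
  | head hstep _ ih =>
    obtain ⟨s, rfl, h₁⟩ := h.of_step hstep
    exact .some s (ih h₁)

theorem Represents.exists_halts {c : Code} {n : ℕ} {Γ Γ' : Config}
    (hacc : (machineGrammar c n).Accessible Γ Γ') {o : Option State} (ho : Halts c n o)
    (h : Represents Γ o) : ∃ o', Halts c n o' ∧ Represents Γ' o' := by
  induction hacc with
  | refl => exact ⟨o, ho, h⟩
  | tail _ hstep ih =>
    obtain ⟨o₁, ho₁, h₁⟩ := ih
    obtain ⟨s, rfl, h₂⟩ := h₁.of_step hstep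
    cases ho₁ with
    | some _ ho₂ => exact ⟨_, ho₂, h₂⟩

theorem isCase_machineGrammar_iff (c : Code) (n : ℕ) (F : Form) :
    (machineGrammar c n).IsCase F ↔ F = .start := by
  constructor
  · rintro ⟨F', hF', xs, σ, -, -, rfl, -⟩
    simp only [machineGrammar, List.mem_singleton] at hF'
    simp [hF', Form.subst, Term.substList]
  · rintro rfl
    exact ⟨.start, List.mem_singleton_self _, [], Term.var, rfl, by simp, rfl, by simp⟩

/-- The machine is deterministic, so that the only case reaches a closed configuration from
everywhere if and only if the machine stops. -/
theorem sound_machineGrammar_iff (c : Code) (n : ℕ) :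
    (machineGrammar c n).Sound ↔ (c.eval [n]).Dom := by
  rw [← halts_start_iff]
  constructor
  · intro h
    obtain ⟨Γ', hacc, hclosed⟩ :=
      h _ ((isCase_machineGrammar_iff c n _).2 rfl) _ Relation.ReflTransGen.refl
    exact represents_initial.halts hacc hclosed
  · intro h F hF Γ hΓ
    obtain rfl := (isCase_machineGrammar_iff c n F).1 hF
    obtain ⟨o, ho, hrep⟩ := represents_initial.exists_halts hΓ h
    exact hrep.exists_isClosed ho

/-! ### Computability of the reduction -/

theorem primrec_ofNum : Primrec Term.ofNum := by
  refine (Primrec.of_equiv_iff Term.equivNat).1 ?_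
  have hstep : Primrec fun t : ℕ => 2 * Nat.pair 1 (Nat.pair t 0 + 1) + 1 :=
    Primrec.succ.comp (Primrec.nat_mul.comp (Primrec.const 2) (Primrec₂.natPair.comp
      (Primrec.const 1) (Primrec.succ.comp (Primrec₂.natPair.comp Primrec.id (Primrec.const 0)))))
  refine (Primrec.nat_rec₁ (Term.toNat .zero) (hstep.comp Primrec.snd).to₂).of_eq fun n => ?_
  induction n with
  | zero => rfl
  | succ n ih =>
    change 2 * Nat.pair 1 (Nat.pair _ 0 + 1) + 1 = _
    rw [ih]
    simp only [Term.equivNat, Equiv.coe_fn_mk, Term.ofNum, Term.toNat, Term.listToNat]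

theorem primrec_cons_nil : Primrec fun t : Term => Term.cons t .nil := by
  refine (Primrec.of_equiv_iff Term.equivNat).1 ?_
  have ht : Primrec fun t : Term => t.toNat := Primrec.of_equiv (e := Term.equivNat)
  exact Primrec.succ.comp (Primrec.nat_mul.comp (Primrec.const 2) (Primrec₂.natPair.comp
    (Primrec.const 3) (Primrec.succ.comp (Primrec₂.natPair.comp ht
      (Primrec.const (Term.listToNat [.nil]))))))

theorem primrec_startProduction (c : Code) : Primrec (startProduction c) := by
  have hform : Primrec fun n => Form.norm (.ofCode c) (.app 11 []) (.cons (.ofNum n) .nil) :=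
    (Primrec.of_equiv_iff Form.equivProd).1 (Primrec.pair (Primrec.const 1) (Primrec.pair
      (Primrec.list_cons.comp (Primrec.const _) (Primrec.list_cons.comp (Primrec.const _)
        (Primrec.list_cons.comp (primrec_cons_nil.comp primrec_ofNum) (Primrec.const []))))
      (Primrec.const [])))
  exact (Primrec.of_equiv_iff Production.equivProd).1
    (Primrec.pair (Primrec.const Form.start) (Primrec.list_cons.comp hform (Primrec.const [])))

theorem primrec_machineGrammar (c : Code) : Primrec (machineGrammar c) :=
  (Primrec.of_equiv_iff Grammar.equivProd).1 (Primrec.pair (Primrec.const machineRanks)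
    (Primrec.pair (Primrec.const machineSorts) (Primrec.pair
      (Primrec.list_cons.comp (primrec_startProduction c) (Primrec.const machineProductions))
      (Primrec.const [Form.start]))))

/-- The halting problem restricted to a single code. -/
theorem exists_code_not_computablePred :
    ∃ c : Code, ¬ ComputablePred fun n : ℕ => (c.eval [n]).Dom := by
  let f : ℕ →. ℕ := fun n => (Denumerable.ofNat Nat.Partrec.Code n).eval 0
  have hf : Partrec f :=
    Nat.Partrec.Code.eval_part.comp (Computable.ofNat _) (Computable.const 0)
  obtain ⟨c, hc⟩ := Code.exists_code (Nat.Partrec'.part_iff₁.2 hf)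
  refine ⟨c, fun h => ComputablePred.halting_problem 0 ?_⟩
  refine ComputablePred.computable_of_manyOneReducible
    ⟨Encodable.encode, Computable.encode, fun d => ?_⟩ h
  have hdom := hc ⟨[Encodable.encode d], rfl⟩
  simp only at hdom
  rw [hdom]
  simp [f, List.Vector.head]

end GuardedAttributeGrammar

theorem mainTheorem1 :
    ¬ ∃ decider : GuardedAttributeGrammar.Grammar → Bool,
      Computable decider ∧
        ∀ G : GuardedAttributeGrammar.Grammar, G.WellFormed →
          (decider G = true ↔ G.Sound) := by
  rintro ⟨decider, hcomp, hdec⟩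
  obtain ⟨c, hc⟩ := GuardedAttributeGrammar.exists_code_not_computablePred
  refine hc (ComputablePred.computable_iff.2 ⟨fun n =>
    decider (GuardedAttributeGrammar.machineGrammar c n),
    hcomp.comp (GuardedAttributeGrammar.primrec_machineGrammar c).to_comp, ?_⟩)
  funext n
  rw [← GuardedAttributeGrammar.sound_machineGrammar_iff,
    hdec _ (GuardedAttributeGrammar.wellFormed_machineGrammar c n)]
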